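/- **The network $G(\Gamma,d,p)$.** For integers $\Gamma\ge 0$, $d\ge 2$, $p\ge 1$, let $G(\Gamma,d,p)$ be the following undirected graph. It consists of $\Gamma$ disjoint paths, the $k$-th being $v^k_0,v^k_1,\dots,v^k_{d^p-1}$ with edges $\{v^k_i,v^k_{i+1}\}$ for $0\le i<d^p-1$; of a complete $d$-ary tree of depth $p$ whose vertices at level $\ell$ ($0\le \ell\le p$) are, from left to right, $u^\ell_0,\dots,u^\ell_{d^\ell-1}$, so that the children of $u^\ell_i$ are $u^{\ell+1}_{di},\dots,u^{\ell+1}_{di+d-1}$; and of all edges $\{u^p_j,v^k_j\}$ with $0\le j<d^p$ and $1\le k\le\Gamma$. Put $s=u^p_0$ and $r=u^p_{d^p-1}$. **The model.** Let $B\ge 1$. In a public-coin distributed algorithm on a network all vertices share one random string, drawn from an arbitrary probability space. The computation proceeds in synchronous rounds. In each round every vertex sends to each of its neighbors a message of at most $B$ bits, which depends only on the sender, on the shared random string, on the sender's input and on the messages that the sender has received in earlier rounds; local computation is unrestricted. Initially $s$ receives a string $x\in\{0,1\}^b$, $r$ receives a string $y\in\{0,1\}^b$, and the other vertices receive no input.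 The algorithm computes $f:\{0,1\}^b\times\{0,1\}^b\to\{0,1\}$ with $\varepsilon$-error if for all $x,y$, with probability at least $1-\varepsilon$, both $s$ and $r$ output $f(x,y)$. Its worst-case running time is the maximum, over all inputs $(x,y)$ and all random strings, of the number of rounds after which both $s$ and $r$ have produced their outputs. Let $\mathrm{disj}(x,y)=1$ if there is no $i$ with $x_i=y_i=1$, and $\mathrm{disj}(x,y)=0$ otherwise. **Lemma.** There are absolute constants $\varepsilon>0$ and $c>0$ such that for all integers $\Gamma\ge 0$, $d\ge 2$, $p\ge 1$, $B\ge 1$ and $b\ge 0$, every public-coin distributed algorithm that computes $\mathrm{disj}$ of $b$-bit strings on $G(\Gamma,d,p)$ with $\varepsilon$-error has worst-case running time at least $$c\cdot\min\Bigl(d^p,\ \frac{b}{d\,p\,B}\Bigr).$$ -/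

import Mathlib

/-- The messages that one edge can carry in one direction in one round of the `B` model:
bit strings of length at most `B` (the empty string means that nothing is sent). -/
abbrev Message (B : ℕ) : Type := {m : List Bool // m.length ≤ B}

/-- A public-coin distributed algorithm in the synchronous `B` model on the network `G`, for
inputs that are `b`-bit strings.  `Ω` is the set of shared random strings and `S` the set of
local states; neither is restricted, and every vertex may use an arbitrary function.
A vertex sees only the random string, its own input (`none` if it receives no input) and the
messages that arrive on its incident edges. -/
structure DistAlg {V : Type*} (G : SimpleGraph V) (B b : ℕ) (Ω S : Type*) where
  /-- the state of a vertex before the first round -/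
  init : Ω → V → Option (Fin b → Bool) → S
  /-- the message that a vertex in a given state sends to a given neighbor -/
  send : Ω → (v : V) → S → G.neighborSet v → Message B
  /-- the new state, from the old one and the messages received from the neighbors -/
  recv : Ω → (v : V) → S → (G.neighborSet v → Message B) → S
  /-- the output of a vertex in a given state; `none` as long as it has not decided -/
  output : Ω → V → S → Option Bool

/-- The assignment of inputs in which `s` receives `x`, `r` receives `y` and no other vertex
receives an input. -/
def twoPartyInput {V : Type*} [DecidableEq V] {b : ℕ} (s r : V) (x y : Fin b → Bool) :
    V → Option (Fin b → Bool) :=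
  fun v => if v = s then some x else if v = r then some y else none

namespace DistAlg

variable {V : Type*} {G : SimpleGraph V} {B b : ℕ} {Ω S : Type*}

/-- The states of all vertices at the end of round `t`, for the random string `ω`. -/
def state (A : DistAlg G B b Ω S) (ω : Ω) (inp : V → Option (Fin b → Bool)) : ℕ → V → S
  | 0, v => A.init ω v (inp v)
  | t + 1, v =>
      A.recv ω v (A.state ω inp t v)
        (fun u => A.send ω u.1 (A.state ω inp t u.1) ⟨v, SimpleGraph.Adj.symm u.2⟩)

/-- Vertex `v` outputs `a`: this is the value it announces the first time it decides. -/
def Outputs (A : DistAlg G B b Ω S) (ω : Ω) (inp : V → Option (Fin b → Bool)) (v : V)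
    (a : Bool) : Prop :=
  ∃ t : ℕ, A.output ω v (A.state ω inp t v) = some a ∧
    ∀ t' < t, A.output ω v (A.state ω inp t' v) = none

/-- The number of rounds after which vertex `v` has produced its output (`⊤` if it never
does). -/
noncomputable def decisionTime (A : DistAlg G B b Ω S) (ω : Ω)
    (inp : V → Option (Fin b → Bool)) (v : V) : ℕ∞ :=
  ⨅ (t : ℕ) (_ : (A.output ω v (A.state ω inp t v)).isSome), (t : ℕ∞)

/-- The worst-case running time of an algorithm in which `s` holds `x` and `r` holds `y`: the
maximum, over all inputs and all random strings, of the number of rounds after which both `s`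
and `r` have produced their outputs. -/
noncomputable def worstCaseTime [DecidableEq V] (A : DistAlg G B b Ω S) (s r : V) : ℕ∞ :=
  ⨆ (x : Fin b → Bool) (y : Fin b → Bool) (ω : Ω),
    max (A.decisionTime ω (twoPartyInput s r x y) s)
      (A.decisionTime ω (twoPartyInput s r x y) r)

/-- When the random string has law `P`, the algorithm computes `f` with `ε`-error: for every
input `(x, y)`, with probability at least `1 - ε` both `s` and `r` output `f x y`. -/
def ComputesWithError [DecidableEq V] [MeasurableSpace Ω] (A : DistAlg G B b Ω S)
    (P : MeasureTheory.Measure Ω) (s r : V)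
    (f : (Fin b → Bool) → (Fin b → Bool) → Bool) (ε : ℝ) : Prop :=
  ∀ x y : Fin b → Bool,
    MeasurableSet {ω | A.Outputs ω (twoPartyInput s r x y) s (f x y) ∧
      A.Outputs ω (twoPartyInput s r x y) r (f x y)} ∧
    1 - ε ≤ P.real {ω | A.Outputs ω (twoPartyInput s r x y) s (f x y) ∧
      A.Outputs ω (twoPartyInput s r x y) r (f x y)}

end DistAlg

/-- The set disjointness function: `true` iff there is no `i` with `x i = y i = 1`. -/
def disj {b : ℕ} (x y : Fin b → Bool) : Bool :=
  decide (∀ i, ¬ (x i = true ∧ y i = true))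

/-- The vertices of `G(Γ, d, p)`: `path k j` is the `j`-th vertex of the `k`-th path, and
`tree l j` is the `j`-th vertex, from left to right, of level `l` of the tree. -/
inductive PTVertex (Γ d p : ℕ) : Type
  | path (k : Fin Γ) (j : Fin (d ^ p)) : PTVertex Γ d p
  | tree (l : Fin (p + 1)) (j : Fin (d ^ (l : ℕ))) : PTVertex Γ d p
  deriving DecidableEq

/-- The edges of `G(Γ, d, p)`, each in one direction: along the paths, from a tree vertex to its
children (those of the `i`-th vertex of a level are the vertices `d * i, …, d * i + d - 1` of the
next level), and the spokes from the `j`-th leaf of the tree to the `j`-th vertex of each path. -/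
def ptEdge (Γ d p : ℕ) : PTVertex Γ d p → PTVertex Γ d p → Prop
  | .path k i, .path k' i' => k = k' ∧ (i : ℕ) + 1 = i'
  | .tree l i, .tree l' i' => (l : ℕ) + 1 = l' ∧ (i' : ℕ) / d = i
  | .tree l i, .path _ j => (l : ℕ) = p ∧ (i : ℕ) = j
  | .path _ _, .tree _ _ => False

/-- The network `G(Γ, d, p)`. -/
def ptGraph (Γ d p : ℕ) : SimpleGraph (PTVertex Γ d p) :=
  SimpleGraph.fromRel (ptEdge Γ d p)

/-- The special vertex `s`, the leftmost leaf of the tree. -/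
def ptS (Γ p : ℕ) {d : ℕ} (hd : 2 ≤ d) : PTVertex Γ d p :=
  .tree (Fin.last p) ⟨0, Nat.pow_pos (by omega)⟩

/-- The special vertex `r`, the rightmost leaf of the tree. -/
def ptR (Γ p : ℕ) {d : ℕ} (hd : 2 ≤ d) : PTVertex Γ d p :=
  .tree (Fin.last p) ⟨d ^ p - 1, Nat.sub_lt (Nat.pow_pos (by omega)) one_pos⟩

/-! Two facts are combined. First, disjointness of `b`-bit strings has public-coin communication
complexity of order `b`, proved here by a corruption bound. Second, a run of `T` rounds with `2 * T
+ 2 ≤ d ^ p` can be simulated by two players exchanging at most `2 * p * d` messages per round.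

Corruption (`disjointness_corruption`): choose `D` uniformly, then `x` inside `D` and `y` inside its
complement. For a rectangle of noticeable weight, the level-one inequality leaves only few
coordinates that are biased given `D`. At any other coordinate, setting both bits to one costs only
a constant factor, so weight on disjoint pairs forces weight on pairs meeting in one point. Summing
over the rectangles of a protocol and averaging over the coins (`exp_le_card_transcripts`), a small
error probability forces exponentially many transcripts.

Simulation (`ptGraph_isSimulationScheme`, `DistAlg.state_crossed`): the left player keeps the
vertices above or at positions up to `d ^ p - 2 - t`, the right player those above or at positions
from `t + 1` on. Both sets retreat by one position per round, so path edges and spokes never carry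
unknown information. News can only enter from a child of one of the `p` tree ancestors of the
boundary leaf. Equal messages on these edges make executions interchangeable, hence the transcript
classes are rectangles.

Comparing the two counts gives `b = O(d * p * B * T)` unless `d ^ p ≤ 2 * T + 2`. -/

/-! ### Averages over subcubes and the level-one inequality. -/

/-- The character of a bit: `1` for `false` and `-1` for `true`. -/
def bitSign (a : Bool) : ℝ := if a then -1 else 1

/-- The mean of `f` over the subcube of all `x` that vanish outside `D`. -/
noncomputable def cubeMean {n : ℕ} (f : (Fin n → Bool) → ℝ) (D : Fin n → Bool) : ℝ :=
  Finset.expect Finset.univ fun z : Fin n → Bool => f fun j => D j && z j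

/-- The mean of `f` over the subcube given by `D`, with the `i`-th coordinate set to `a`. -/
noncomputable def cubeMeanAt {n : ℕ} (f : (Fin n → Bool) → ℝ) (D : Fin n → Bool) (i : Fin n)
    (a : Bool) : ℝ :=
  Finset.expect Finset.univ fun z : Fin n → Bool =>
    f (Function.update (fun j => D j && z j) i a)

/-- The first-order Fourier coefficient of `f` at `i` on the subcube given by `D`. -/
noncomputable def cubeBias {n : ℕ} (f : (Fin n → Bool) → ℝ) (D : Fin n → Bool) (i : Fin n) : ℝ :=
  Finset.expect Finset.univ fun z : Fin n → Bool => f (fun j => D j && z j) * bitSign (z i)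

/-- On the subcube given by `D`, the `i`-th bit is far from balanced under the density `f`. -/
def Unbalanced {n : ℕ} (f : (Fin n → Bool) → ℝ) (D : Fin n → Bool) (i : Fin n) : Prop :=
  cubeMean f D < 2 * |cubeBias f D i|

theorem expect_eq_expect_update {n : ℕ} (h : (Fin n → Bool) → ℝ) (i : Fin n) :
    Finset.expect Finset.univ h = Finset.expect Finset.univ fun z : Fin n → Bool =>
      (h (Function.update z i true) + h (Function.update z i false)) / 2 := by
  have hinv : Function.Involutive fun z : Fin n → Bool => Function.update z i (!z i) := by
    intro z
    simp
  have hflip : Finset.expect Finset.univ h =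
      Finset.expect Finset.univ fun z : Fin n → Bool => h (Function.update z i (!z i)) :=
    (Fintype.expect_equiv hinv.toPerm _ _ fun z => rfl).symm
  have hsum : Finset.expect Finset.univ (fun z : Fin n → Bool =>
      (h (Function.update z i true) + h (Function.update z i false)) / 2) =
      Finset.expect Finset.univ (fun z : Fin n → Bool =>
        (h z + h (Function.update z i (!z i))) / 2) := by
    refine Finset.expect_congr rfl fun z _ => ?_
    rcases hz : z i
    · have : Function.update z i false = z := by rw [← hz, Function.update_eq_self]
      rw [this]
      simp [add_comm]
    · have : Function.update z i true = z := by rw [← hz, Function.update_eq_self]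
      rw [this]
      simp
  rw [hsum, ← Finset.expect_div, Finset.expect_add_distrib, ← hflip]
  ring

theorem and_update_right {n : ℕ} (D z : Fin n → Bool) (i : Fin n) (a : Bool) (hi : D i = true) :
    (fun j => D j && Function.update z i a j) = Function.update (fun j => D j && z j) i a := by
  ext j
  by_cases h : j = i
  · subst h
    simp [hi]
  · simp [h]

theorem cubeMean_of_false {n : ℕ} (f : (Fin n → Bool) → ℝ) {D : Fin n → Bool} {i : Fin n}
    (hi : D i = false) : cubeMean f D = cubeMeanAt f D i false := by
  refine Finset.expect_congr rfl fun z _ => congrArg f ?_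
  ext j
  by_cases h : j = i
  · subst h
    simp [hi]
  · simp [h]

theorem cubeMean_of_true {n : ℕ} (f : (Fin n → Bool) → ℝ) {D : Fin n → Bool} {i : Fin n}
    (hi : D i = true) :
    cubeMean f D = (cubeMeanAt f D i true + cubeMeanAt f D i false) / 2 := by
  rw [cubeMean, expect_eq_expect_update _ i, ← Finset.expect_div, Finset.expect_add_distrib]
  simp only [and_update_right D _ i _ hi]
  rfl

theorem cubeBias_of_true {n : ℕ} (f : (Fin n → Bool) → ℝ) {D : Fin n → Bool} {i : Fin n}
    (hi : D i = true) :
    cubeBias f D i = (cubeMeanAt f D i false - cubeMeanAt f D i true) / 2 := by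
  rw [cubeBias, expect_eq_expect_update _ i, ← Finset.expect_div, Finset.expect_add_distrib]
  simp only [and_update_right D _ i _ hi, Function.update_self, bitSign, if_true,
    Bool.false_eq_true, if_false, mul_one, mul_neg, Finset.expect_neg_distrib]
  unfold cubeMeanAt
  ring

theorem cubeMeanAt_update {n : ℕ} (f : (Fin n → Bool) → ℝ) (D : Fin n → Bool) (i : Fin n)
    (a c : Bool) : cubeMeanAt f (Function.update D i c) i a = cubeMeanAt f D i a := by
  refine Finset.expect_congr rfl fun z _ => congrArg f ?_
  ext j
  by_cases h : j = i
  · subst h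
    simp
  · simp [h]

theorem expect_exp_sum_bitSign {n : ℕ} (β : Fin n → ℝ) :
    (Finset.expect Finset.univ fun z : Fin n → Bool => Real.exp (∑ i, β i * bitSign (z i))) =
      ∏ i, Real.cosh (β i) := by
  have h : ∏ i, (2 * Real.cosh (β i)) =
      ∑ z : Fin n → Bool, Real.exp (∑ i, β i * bitSign (z i)) := by
    have h1 : ∀ i, 2 * Real.cosh (β i) = ∑ a : Bool, Real.exp (β i * bitSign a) := by
      intro i
      rw [Real.cosh_eq]
      simp [bitSign]
      ring
    simp only [h1, Real.exp_sum]
    rw [Finset.prod_univ_sum, Fintype.piFinset_univ]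
  rw [Fintype.expect_eq_sum_div_card, ← h, Finset.prod_mul_distrib]
  simp

/-- The level-one inequality on the discrete cube. -/
theorem sum_sq_bias_le {n : ℕ} (h : (Fin n → Bool) → ℝ) (h0 : ∀ z, 0 ≤ h z) (h1 : ∀ z, h z ≤ 1)
    (hpos : 0 < Finset.expect Finset.univ h) :
    ∑ i, ((Finset.expect Finset.univ fun z => h z * bitSign (z i)) /
      Finset.expect Finset.univ h) ^ 2 ≤ -2 * Real.log (Finset.expect Finset.univ h) := by
  set F := Finset.expect Finset.univ h with hF
  set β : Fin n → ℝ := fun i =>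
    (Finset.expect Finset.univ fun z => h z * bitSign (z i)) / F with hβ
  set m := ∑ i, β i ^ 2 with hm
  have hlin : (Finset.expect Finset.univ fun z : Fin n → Bool =>
      h z * ∑ i, β i * bitSign (z i)) = F * m := by
    simp only [Finset.mul_sum]
    rw [Finset.expect_sum_comm, hm, Finset.mul_sum]
    refine Finset.sum_congr rfl fun i _ => ?_
    have : (Finset.expect Finset.univ fun z : Fin n → Bool => h z * (β i * bitSign (z i))) =
        β i * Finset.expect Finset.univ fun z : Fin n → Bool => h z * bitSign (z i) := by
      rw [Finset.mul_expect]
      exact Finset.expect_congr rfl fun z _ => by ring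
    rw [this]
    have h2 : (Finset.expect Finset.univ fun z : Fin n → Bool => h z * bitSign (z i)) = F * β i := by
      rw [hβ]
      field_simp
    rw [h2]
    ring
  -- Jensen for the density `h / F`, under which the exponent has mean `m`: use the tangent line of
  -- `exp` at `m`.
  have hlow : F * Real.exp m ≤ Finset.expect Finset.univ fun z : Fin n → Bool =>
      h z * Real.exp (∑ i, β i * bitSign (z i)) := by
    have h3 : (Finset.expect Finset.univ fun z : Fin n → Bool =>
        Real.exp m * (h z * ∑ i, β i * bitSign (z i)) + Real.exp m * (1 - m) * h z) =
        F * Real.exp m := by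
      rw [Finset.expect_add_distrib, ← Finset.mul_expect, ← Finset.mul_expect, hlin, ← hF]
      ring
    rw [← h3]
    refine Finset.expect_le_expect fun z _ => ?_
    have h4 := Real.add_one_le_exp (∑ i, β i * bitSign (z i) - m)
    have h5 : Real.exp (∑ i, β i * bitSign (z i)) =
        Real.exp m * Real.exp (∑ i, β i * bitSign (z i) - m) := by
      rw [← Real.exp_add]
      congr 1
      ring
    rw [h5]
    have h6 := mul_le_mul_of_nonneg_left h4 (mul_nonneg (h0 z) (Real.exp_pos m).le)
    linarith
  -- Dropping `h ≤ 1` leaves independent signs. Together with `hlow` this gives `F * exp m ≤ exp (m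
  -- / 2)`.
  have hup : (Finset.expect Finset.univ fun z : Fin n → Bool =>
      h z * Real.exp (∑ i, β i * bitSign (z i))) ≤ Real.exp (m / 2) := by
    calc _ ≤ Finset.expect Finset.univ fun z : Fin n → Bool =>
          Real.exp (∑ i, β i * bitSign (z i)) :=
          Finset.expect_le_expect fun z _ => mul_le_of_le_one_left (Real.exp_pos _).le (h1 z)
      _ = ∏ i, Real.cosh (β i) := expect_exp_sum_bitSign β
      _ ≤ ∏ i, Real.exp (β i ^ 2 / 2) :=
          Finset.prod_le_prod (fun i _ => (Real.cosh_pos _).le)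
            fun i _ => Real.cosh_le_exp_half_sq _
      _ = Real.exp (m / 2) := by rw [← Real.exp_sum, hm, Finset.sum_div]
  have hlog := Real.log_le_log (mul_pos hpos (Real.exp_pos m)) (hlow.trans hup)
  rw [Real.log_mul hpos.ne' (Real.exp_pos m).ne', Real.log_exp, Real.log_exp] at hlog
  linarith

theorem cubeMean_nonneg {n : ℕ} {f : (Fin n → Bool) → ℝ} (h0 : ∀ z, 0 ≤ f z)
    (D : Fin n → Bool) : 0 ≤ cubeMean f D :=
  Finset.expect_nonneg fun _ _ => h0 _

theorem cubeMeanAt_nonneg {n : ℕ} {f : (Fin n → Bool) → ℝ} (h0 : ∀ z, 0 ≤ f z)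
    (D : Fin n → Bool) (i : Fin n) (a : Bool) : 0 ≤ cubeMeanAt f D i a :=
  Finset.expect_nonneg fun _ _ => h0 _

-- Each unbalanced coordinate has normalized bias above `1 / 2`, so it uses at least `1 / 4` of the
-- level-one budget.
open Classical in
theorem card_unbalanced_le {n : ℕ} {f : (Fin n → Bool) → ℝ} (h0 : ∀ z, 0 ≤ f z)
    (h1 : ∀ z, f z ≤ 1) (D : Fin n → Bool) (hpos : 0 < cubeMean f D) :
    ((Finset.univ.filter fun i => Unbalanced f D i).card : ℝ) ≤ -8 * Real.log (cubeMean f D) := by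
  have h := sum_sq_bias_le (fun z => f fun j => D j && z j) (fun z => h0 _) (fun z => h1 _) hpos
  have hle : ((Finset.univ.filter fun i => Unbalanced f D i).card : ℝ) * (1 / 4) ≤
      ∑ i, (cubeBias f D i / cubeMean f D) ^ 2 := by
    calc _ = ∑ i ∈ Finset.univ.filter fun i => Unbalanced f D i, (1 / 4 : ℝ) := by simp
      _ ≤ ∑ i ∈ Finset.univ.filter fun i => Unbalanced f D i,
          (cubeBias f D i / cubeMean f D) ^ 2 := by
        refine Finset.sum_le_sum fun i hi => ?_
        have hu : cubeMean f D < 2 * |cubeBias f D i| := (Finset.mem_filter.1 hi).2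
        have h2 : 1 / 2 ≤ |cubeBias f D i / cubeMean f D| := by
          rw [abs_div, abs_of_pos hpos, le_div_iff₀ hpos]
          linarith
        rw [← sq_abs]
        nlinarith
      _ ≤ _ := Finset.sum_le_sum_of_subset_of_nonneg (Finset.filter_subset _ _)
          fun i _ _ => sq_nonneg _
  have h' : ∑ i, (cubeBias f D i / cubeMean f D) ^ 2 ≤ -2 * Real.log (cubeMean f D) := h
  linarith

/-! ### The corruption bound for one rectangle. -/

/-- The two-point inequality behind the corruption bound. -/
theorem two_point_corruption {a a' b b' u v : ℝ} (ha : 0 ≤ a) (ha' : 0 ≤ a') (hb : 0 ≤ b)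
    (hb' : 0 ≤ b') (hu : 0 ≤ u) (hv : 0 ≤ v)
    (hua : u < 1 → |a - a'| ≤ (a' + a) / 2) (hvb : v < 1 → |b - b'| ≤ (b' + b) / 2) :
    (a' + a) / 2 * b + a * ((b' + b) / 2) ≤
      12 * (a' * b') + 5 * (u * ((a' + a) / 2 * b) + v * (a * ((b' + b) / 2))) := by
  have hab := mul_nonneg ha hb
  have hab' := mul_nonneg ha hb'
  have ha'b := mul_nonneg ha' hb
  have ha'b' := mul_nonneg ha' hb'
  have hU : 0 ≤ (a' + a) / 2 * b := by positivity
  have hV : 0 ≤ a * ((b' + b) / 2) := by positivity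
  have huU := mul_nonneg hu hU
  have hvV := mul_nonneg hv hV
  rcases lt_or_ge u 1 with hu1 | hu1 <;> rcases lt_or_ge v 1 with hv1 | hv1
  -- Both bits are balanced: `a ≤ 3 * a'` and `b ≤ 3 * b'`, so the left side `(a' * b + a * b' + 2 *
  -- a * b) / 2` is at most `(3 + 3 + 18) / 2` times `a' * b'`.
  · have h1 := abs_le.1 (hua hu1)
    have h2 := abs_le.1 (hvb hv1)
    have e1 : a * b' ≤ 3 * a' * b' := mul_le_mul_of_nonneg_right (by linarith) hb'
    have e2 : a' * b ≤ a' * (3 * b') := mul_le_mul_of_nonneg_left (by linarith) ha'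
    have e3 : a * b ≤ a * (3 * b') := mul_le_mul_of_nonneg_left (by linarith) ha
    nlinarith
  -- Only the second bit is unbalanced: `a' ≤ 3 * a` bounds the first summand by four times the
  -- second, which the `v` term pays for; hence the factor 5.
  · have h1 := abs_le.1 (hua hu1)
    have e1 : a' * b ≤ 3 * a * b := mul_le_mul_of_nonneg_right (by linarith) hb
    have e2 := mul_le_mul_of_nonneg_right hv1 hV
    nlinarith
  · have h2 := abs_le.1 (hvb hv1)
    have e1 : a * b' ≤ a * (3 * b) := mul_le_mul_of_nonneg_left (by linarith) ha
    have e2 := mul_le_mul_of_nonneg_right hu1 hU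
    nlinarith
  · have e1 := mul_le_mul_of_nonneg_right hu1 hU
    have e2 := mul_le_mul_of_nonneg_right hv1 hV
    nlinarith

open Classical in
/-- One coordinate of the corruption bound. -/
theorem expect_cubeMean_mul_le {n : ℕ} {f g : (Fin n → Bool) → ℝ} (f0 : ∀ z, 0 ≤ f z)
    (g0 : ∀ z, 0 ≤ g z) (i : Fin n) :
    (Finset.expect Finset.univ fun D : Fin n → Bool =>
      cubeMean f D * cubeMean g (fun j => !D j)) ≤
    6 * (Finset.expect Finset.univ fun D : Fin n → Bool =>
      cubeMeanAt f D i true * cubeMeanAt g (fun j => !D j) i true) +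
    5 * (Finset.expect Finset.univ fun D : Fin n → Bool =>
      ((if Unbalanced f D i then 1 else 0) + (if Unbalanced g (fun j => !D j) i then 1 else 0)) *
        (cubeMean f D * cubeMean g (fun j => !D j))) := by
  have hneg : ∀ (D : Fin n → Bool) (a : Bool), (fun j => !(Function.update D i a) j) =
      Function.update (fun j => !D j) i (!a) := by
    intro D a
    ext j
    by_cases h : j = i
    · subst h
      simp
    · simp [h]
  rw [expect_eq_expect_update _ i,
    expect_eq_expect_update (fun D : Fin n → Bool => (_ + _) * (_ * _)) i,
    Finset.mul_expect, Finset.mul_expect, ← Finset.expect_add_distrib]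
  refine Finset.expect_le_expect fun D _ => ?_
  simp only [hneg, Bool.not_true, Bool.not_false]
  set E : Fin n → Bool := fun j => !D j with hE
  have hft := cubeMean_of_true f (D := Function.update D i true) (i := i) (by simp)
  have hff := cubeMean_of_false f (D := Function.update D i false) (i := i) (by simp)
  have hgt := cubeMean_of_true g (D := Function.update E i true) (i := i) (by simp)
  have hgf := cubeMean_of_false g (D := Function.update E i false) (i := i) (by simp)
  have hbf := cubeBias_of_true f (D := Function.update D i true) (i := i) (by simp)
  have hbg := cubeBias_of_true g (D := Function.update E i true) (i := i) (by simp)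
  simp only [cubeMeanAt_update] at hft hff hgt hgf hbf hbg
  have key := two_point_corruption (cubeMeanAt_nonneg f0 D i false) (cubeMeanAt_nonneg f0 D i true)
    (cubeMeanAt_nonneg g0 E i false) (cubeMeanAt_nonneg g0 E i true)
    (u := if Unbalanced f (Function.update D i true) i then 1 else 0)
    (v := if Unbalanced g (Function.update E i true) i then 1 else 0)
    (by positivity) (by positivity)
    (by
      intro h
      have h1 : ¬ Unbalanced f (Function.update D i true) i := by
        intro h2
        simp [h2] at h
      rw [Unbalanced, hft, hbf, abs_div, abs_two] at h1
      linarith)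
    (by
      intro h
      have h1 : ¬ Unbalanced g (Function.update E i true) i := by
        intro h2
        simp [h2] at h
      rw [Unbalanced, hgt, hbg, abs_div, abs_two] at h1
      linarith)
  rw [← hft, ← hff, ← hgt, ← hgf] at key
  -- Imbalance matters only for the player whose `i`-th bit is free; the other indicator is
  -- discarded as nonnegative.
  have p1 : 0 ≤ (if Unbalanced g (Function.update E i false) i then (1 : ℝ) else 0) *
      (cubeMean f (Function.update D i true) * cubeMean g (Function.update E i false)) :=
    mul_nonneg (by positivity) (mul_nonneg (cubeMean_nonneg f0 _) (cubeMean_nonneg g0 _))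
  have p2 : 0 ≤ (if Unbalanced f (Function.update D i false) i then (1 : ℝ) else 0) *
      (cubeMean f (Function.update D i false) * cubeMean g (Function.update E i true)) :=
    mul_nonneg (by positivity) (mul_nonneg (cubeMean_nonneg f0 _) (cubeMean_nonneg g0 _))
  linarith

-- Either the product of the means is below `exp (-(n / 80))` and the trivial count `2 * n`
-- suffices, or its logarithm is at least `-(n / 80)` and the level-one count is at most `8 * n /
-- 80`.
open Classical in
theorem card_unbalanced_mul_le {n : ℕ} {f g : (Fin n → Bool) → ℝ} (f0 : ∀ z, 0 ≤ f z)
    (f1 : ∀ z, f z ≤ 1) (g0 : ∀ z, 0 ≤ g z) (g1 : ∀ z, g z ≤ 1) (D E : Fin n → Bool) :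
    (((Finset.univ.filter fun i => Unbalanced f D i).card : ℝ) +
      ((Finset.univ.filter fun i => Unbalanced g E i).card : ℝ)) * (cubeMean f D * cubeMean g E) ≤
    n / 10 * (cubeMean f D * cubeMean g E) + 2 * n * Real.exp (-(n / 80)) := by
  have hF := cubeMean_nonneg f0 D
  have hG := cubeMean_nonneg g0 E
  have hW := mul_nonneg hF hG
  rcases lt_or_ge (cubeMean f D * cubeMean g E) (Real.exp (-(n / 80))) with h | h
  · have c1 : ((Finset.univ.filter fun i => Unbalanced f D i).card : ℝ) ≤ n := by
      exact_mod_cast (Finset.card_le_univ _).trans (by simp)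
    have c2 : ((Finset.univ.filter fun i => Unbalanced g E i).card : ℝ) ≤ n := by
      exact_mod_cast (Finset.card_le_univ _).trans (by simp)
    have h3 : (((Finset.univ.filter fun i => Unbalanced f D i).card : ℝ) +
      ((Finset.univ.filter fun i => Unbalanced g E i).card : ℝ)) * (cubeMean f D * cubeMean g E) ≤
        (2 * n) * Real.exp (-(n / 80)) := mul_le_mul (by linarith) h.le hW (by positivity)
    have : (0 : ℝ) ≤ n / 10 * (cubeMean f D * cubeMean g E) := by positivity
    linarith
  · have hWpos := (Real.exp_pos _).trans_le h
    have hFpos : 0 < cubeMean f D := lt_of_le_of_ne hF fun h0 => by simp [← h0] at hWpos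
    have hGpos : 0 < cubeMean g E := lt_of_le_of_ne hG fun h0 => by simp [← h0] at hWpos
    have c1 := card_unbalanced_le f0 f1 D hFpos
    have c2 := card_unbalanced_le g0 g1 E hGpos
    have hlog := Real.log_le_log (Real.exp_pos _) h
    rw [Real.log_exp, Real.log_mul hFpos.ne' hGpos.ne'] at hlog
    have h3 := mul_le_mul_of_nonneg_right (show
      (((Finset.univ.filter fun i => Unbalanced f D i).card : ℝ) +
        ((Finset.univ.filter fun i => Unbalanced g E i).card : ℝ)) ≤ n / 10 by linarith) hW
    have : (0 : ℝ) ≤ 2 * n * Real.exp (-(n / 80)) := by positivity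
    linarith

/-- Corruption bound for set disjointness: a rectangle that is not exponentially small contains
about as much weight on uniquely intersecting pairs as on disjoint ones. -/
theorem disjointness_corruption {n : ℕ} {f g : (Fin n → Bool) → ℝ} (f0 : ∀ z, 0 ≤ f z)
    (f1 : ∀ z, f z ≤ 1) (g0 : ∀ z, 0 ≤ g z) (g1 : ∀ z, g z ≤ 1) :
    n * (Finset.expect Finset.univ fun D : Fin n → Bool =>
      cubeMean f D * cubeMean g (fun j => !D j)) ≤
    12 * (∑ i, Finset.expect Finset.univ fun D : Fin n → Bool =>
      cubeMeanAt f D i true * cubeMeanAt g (fun j => !D j) i true) +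
    20 * n * Real.exp (-(n / 80)) := by
  classical
  set M := Finset.expect Finset.univ fun D : Fin n → Bool =>
      cubeMean f D * cubeMean g (fun j => !D j) with hM
  have h1 := Finset.sum_le_sum fun (i : Fin n) (_ : i ∈ Finset.univ) =>
    expect_cubeMean_mul_le f0 g0 i
  rw [Finset.sum_add_distrib, ← Finset.mul_sum, ← Finset.mul_sum, ← hM] at h1
  simp only [Finset.sum_const, Finset.card_univ, Fintype.card_fin, nsmul_eq_mul] at h1
  have h2 : (∑ i, Finset.expect Finset.univ fun D : Fin n → Bool =>
      ((if Unbalanced f D i then 1 else 0) + (if Unbalanced g (fun j => !D j) i then 1 else 0)) *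
        (cubeMean f D * cubeMean g (fun j => !D j))) ≤
      n / 10 * M + 2 * n * Real.exp (-(n / 80)) := by
    rw [← Finset.expect_sum_comm]
    have h3 : n / 10 * M + 2 * n * Real.exp (-(n / 80)) =
        Finset.expect Finset.univ fun D : Fin n → Bool =>
          n / 10 * (cubeMean f D * cubeMean g (fun j => !D j)) +
            2 * n * Real.exp (-(n / 80)) := by
      rw [Finset.expect_add_distrib, ← Finset.mul_expect, Finset.expect_const]
      exact Finset.univ_nonempty
    rw [h3]
    refine Finset.expect_le_expect fun D _ => ?_
    rw [← Finset.sum_mul, Finset.sum_add_distrib]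
    simp only [Finset.sum_boole]
    exact card_unbalanced_mul_le f0 f1 g0 g1 D _
  -- The unbalanced coordinates contribute at most `5 * (n / 10) * M`, half of the left side, and
  -- are absorbed there.
  linarith

/-! ### From rectangles to public-coin protocols. -/

/-- The mean of `a x y` over random disjoint pairs `(x, y)`. -/
noncomputable def disjointMean {n : ℕ} (a : (Fin n → Bool) → (Fin n → Bool) → ℝ) : ℝ :=
  Finset.expect Finset.univ fun q : (Fin n → Bool) × (Fin n → Bool) × (Fin n → Bool) =>
    a (fun j => q.1 j && q.2.1 j) (fun j => !q.1 j && q.2.2 j)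

/-- The mean of `a x y` over random pairs `(x, y)` that intersect exactly in `i`. -/
noncomputable def intersectingMean {n : ℕ} (i : Fin n)
    (a : (Fin n → Bool) → (Fin n → Bool) → ℝ) : ℝ :=
  Finset.expect Finset.univ fun q : (Fin n → Bool) × (Fin n → Bool) × (Fin n → Bool) =>
    a (Function.update (fun j => q.1 j && q.2.1 j) i true)
      (Function.update (fun j => !q.1 j && q.2.2 j) i true)

theorem disjointMean_mul {n : ℕ} (f g : (Fin n → Bool) → ℝ) :
    disjointMean (fun x y => f x * g y) = Finset.expect Finset.univ fun D : Fin n → Bool =>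
      cubeMean f D * cubeMean g (fun j => !D j) := by
  unfold disjointMean cubeMean
  rw [← Finset.univ_product_univ, Finset.expect_product]
  refine Finset.expect_congr rfl fun D _ => ?_
  rw [← Finset.univ_product_univ, Finset.expect_product, Finset.expect_mul_expect]

theorem intersectingMean_mul {n : ℕ} (i : Fin n) (f g : (Fin n → Bool) → ℝ) :
    intersectingMean i (fun x y => f x * g y) = Finset.expect Finset.univ fun D : Fin n → Bool =>
      cubeMeanAt f D i true * cubeMeanAt g (fun j => !D j) i true := by
  unfold intersectingMean cubeMeanAt
  rw [← Finset.univ_product_univ, Finset.expect_product]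
  refine Finset.expect_congr rfl fun D _ => ?_
  rw [← Finset.univ_product_univ, Finset.expect_product, Finset.expect_mul_expect]

/-- The corruption bound for a disjoint union of rectangles, given as the part of the classes of a
partition into rectangles on which a function that depends on the row only is true. -/
theorem corruption_of_rectangles {n : ℕ} {ι : Type*} [Fintype ι]
    (τ : (Fin n → Bool) → (Fin n → Bool) → ι) (out : (Fin n → Bool) → (Fin n → Bool) → Prop)
    [∀ x y, Decidable (out x y)]
    (hrect : ∀ x y x' y', τ x y = τ x' y' → τ x y' = τ x y ∧ (out x y' ↔ out x y)) :
    n * disjointMean (fun x y => if out x y then (1 : ℝ) else 0) ≤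
      12 * ∑ i, intersectingMean i (fun x y => if out x y then (1 : ℝ) else 0) +
        Fintype.card ι * (20 * n * Real.exp (-(n / 80))) := by
  classical
  let f : ι → (Fin n → Bool) → ℝ := fun k x => if ∃ y, τ x y = k ∧ out x y then 1 else 0
  let g : ι → (Fin n → Bool) → ℝ := fun k y => if ∃ x, τ x y = k then 1 else 0
  have hsum : (fun x y => if out x y then (1 : ℝ) else 0) = fun x y => ∑ k, f k x * g k y := by
    ext x y
    rw [Finset.sum_eq_single (τ x y)]
    · have hg : g (τ x y) y = 1 := if_pos ⟨x, rfl⟩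
      rw [hg, mul_one]
      by_cases h : out x y
      · rw [if_pos h]
        exact (if_pos ⟨y, rfl, h⟩).symm
      · rw [if_neg h]
        refine (if_neg ?_).symm
        rintro ⟨y', h1, h2⟩
        exact h ((hrect x y' x y h1).2.2 h2)
    · intro k _ hk
      by_contra hne
      have hf : ∃ y, τ x y = k ∧ out x y := by
        by_contra h
        exact hne (by simp [f, if_neg h])
      have hg : ∃ x, τ x y = k := by
        by_contra h
        exact hne (by simp [g, if_neg h])
      obtain ⟨y', h1, -⟩ := hf
      obtain ⟨x', h2⟩ := hg
      exact hk (((hrect x y' x' y (h1.trans h2.symm)).1.trans h1).symm)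
    · simp
  have hf0 : ∀ k x, 0 ≤ f k x := fun k x => by positivity
  have hg0 : ∀ k x, 0 ≤ g k x := fun k x => by positivity
  have hf1 : ∀ k x, f k x ≤ 1 := fun k x => by
    simp only [f]
    split_ifs <;> norm_num
  have hg1 : ∀ k x, g k x ≤ 1 := fun k x => by
    simp only [g]
    split_ifs <;> norm_num
  have hd : disjointMean (fun x y => ∑ k, f k x * g k y) =
      ∑ k, disjointMean (fun x y => f k x * g k y) := Finset.expect_sum_comm _ _ _
  have hi : ∀ i, intersectingMean i (fun x y => ∑ k, f k x * g k y) =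
      ∑ k, intersectingMean i (fun x y => f k x * g k y) := fun i => Finset.expect_sum_comm _ _ _
  rw [hsum, hd]
  simp only [hi]
  rw [Finset.sum_comm, Finset.mul_sum, Finset.mul_sum]
  have hc : (Fintype.card ι : ℝ) * (20 * n * Real.exp (-(n / 80))) =
      ∑ _k : ι, 20 * n * Real.exp (-(n / 80)) := by simp
  rw [hc, ← Finset.sum_add_distrib]
  refine Finset.sum_le_sum fun k _ => ?_
  simp only [disjointMean_mul, intersectingMean_mul]
  exact disjointness_corruption (hf0 k) (hf1 k) (hg0 k) (hg1 k)

open MeasureTheory in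
theorem integral_expect_indicator {Ω Q : Type*} [MeasurableSpace Ω] (P : Measure Ω)
    [IsProbabilityMeasure P] [Fintype Q] {E : Q → Set Ω} (hE : ∀ q, MeasurableSet (E q)) :
    Integrable (fun ω => Finset.expect Finset.univ fun q => (E q).indicator (fun _ => (1 : ℝ)) ω) P ∧
    ∫ ω, (Finset.expect Finset.univ fun q => (E q).indicator (fun _ => (1 : ℝ)) ω) ∂P =
      Finset.expect Finset.univ fun q => P.real (E q) := by
  have hint : ∀ q ∈ (Finset.univ : Finset Q),
      Integrable ((E q).indicator fun _ => (1 : ℝ)) P :=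
    fun q _ => (integrable_const 1).indicator (hE q)
  simp only [Fintype.expect_eq_sum_div_card]
  refine ⟨(integrable_finsetSum _ hint).div_const _, ?_⟩
  rw [integral_div, integral_finsetSum _ hint]
  congr 1
  refine Finset.sum_congr rfl fun q _ => ?_
  rw [integral_indicator_const _ (hE q), smul_eq_mul, mul_one]

open MeasureTheory in
/-- A public-coin protocol for set disjointness with small error has exponentially many
transcripts. -/
theorem exp_le_card_transcripts {n : ℕ} (hn : 1 ≤ n) {ι : Type*} [Fintype ι] {Ω : Type*}
    [MeasurableSpace Ω] (P : Measure Ω) [IsProbabilityMeasure P]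
    (τ : Ω → (Fin n → Bool) → (Fin n → Bool) → ι)
    (out : Ω → (Fin n → Bool) → (Fin n → Bool) → Prop)
    (hrect : ∀ ω x y x' y', τ ω x y = τ ω x' y' →
      τ ω x y' = τ ω x y ∧ (out ω x y' ↔ out ω x y))
    (E : (Fin n → Bool) → (Fin n → Bool) → Set Ω) (hE : ∀ x y, MeasurableSet (E x y))
    (hP : ∀ x y, 25 / 26 ≤ P.real (E x y))
    (htrue : ∀ x y, disj x y = true → ∀ ω ∈ E x y, out ω x y)
    (hfalse : ∀ x y, disj x y = false → ∀ ω ∈ E x y, ¬ out ω x y) :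
    Real.exp (n / 80) ≤ 40 * Fintype.card ι := by
  classical
  let Q := (Fin n → Bool) × (Fin n → Bool) × (Fin n → Bool)
  let E0 : Q → Set Ω := fun q => E (fun j => q.1 j && q.2.1 j) (fun j => !q.1 j && q.2.2 j)
  let E1 : Fin n → Q → Set Ω := fun i q =>
    (E (Function.update (fun j => q.1 j && q.2.1 j) i true)
      (Function.update (fun j => !q.1 j && q.2.2 j) i true))ᶜ
  have h0 := integral_expect_indicator P (E := E0) fun q => hE _ _
  have h1 := fun i => integral_expect_indicator P (E := E1 i) fun q => (hE _ _).compl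
  set C : ℝ := Fintype.card ι * (20 * n * Real.exp (-(n / 80))) with hC
  have hpt : ∀ ω, (n : ℝ) * (Finset.expect Finset.univ fun q =>
        (E0 q).indicator (fun _ => (1 : ℝ)) ω) ≤
      12 * (∑ i, Finset.expect Finset.univ fun q =>
        (E1 i q).indicator (fun _ => (1 : ℝ)) ω) + C := by
    intro ω
    have hc := corruption_of_rectangles (τ ω) (out ω) (hrect ω)
    -- Only the events `E` are known to be measurable, not `out`; so `out` is compared with their
    -- indicators for each `ω` before integrating.
    have ha : (Finset.expect Finset.univ fun q => (E0 q).indicator (fun _ => (1 : ℝ)) ω) ≤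
        disjointMean (fun x y => if out ω x y then (1 : ℝ) else 0) := by
      refine Finset.expect_le_expect fun q _ => ?_
      beta_reduce
      by_cases hq : ω ∈ E0 q
      · rw [Set.indicator_of_mem hq, if_pos (htrue _ _ _ ω hq)]
        simp only [disj, decide_eq_true_eq]
        intro j
        cases q.1 j <;> simp
      · rw [Set.indicator_of_notMem hq]
        positivity
    have hb : ∀ i, intersectingMean i (fun x y => if out ω x y then (1 : ℝ) else 0) ≤
        Finset.expect Finset.univ fun q => (E1 i q).indicator (fun _ => (1 : ℝ)) ω := by
      intro i
      refine Finset.expect_le_expect fun q _ => ?_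
      beta_reduce
      by_cases hq : ω ∈ E1 i q
      · rw [Set.indicator_of_mem hq]
        split_ifs <;> norm_num
      · rw [Set.indicator_of_notMem hq, if_neg]
        refine hfalse _ _ ?_ ω (Set.notMem_compl_iff.1 hq)
        simp only [disj, decide_eq_false_iff_not]
        intro h
        exact h i (by simp)
    have hb' := Finset.sum_le_sum fun (i : Fin n) (_ : i ∈ Finset.univ) => hb i
    have ha' := mul_le_mul_of_nonneg_left ha (Nat.cast_nonneg (α := ℝ) n)
    linarith
  have hI : Integrable (fun ω => ∑ i, Finset.expect Finset.univ fun q =>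
      (E1 i q).indicator (fun _ => (1 : ℝ)) ω) P := integrable_finsetSum _ fun i _ => (h1 i).1
  have hmono := integral_mono (h0.1.const_mul (n : ℝ))
    ((hI.const_mul 12).add (integrable_const C)) hpt
  simp only [Pi.add_apply] at hmono
  rw [integral_const_mul, h0.2, integral_add (hI.const_mul 12) (integrable_const C),
    integral_const_mul, integral_finsetSum _ fun i _ => (h1 i).1] at hmono
  simp only [h1, integral_const, probReal_univ, one_smul] at hmono
  have hl : (25 / 26 : ℝ) ≤ Finset.expect Finset.univ fun q => P.real (E0 q) :=
    Finset.le_expect Finset.univ_nonempty fun q _ => hP _ _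
  have hr : ∀ i, (Finset.expect Finset.univ fun q => P.real (E1 i q)) ≤ 1 / 26 := by
    intro i
    refine Finset.expect_le Finset.univ_nonempty fun q _ => ?_
    rw [probReal_compl_eq_one_sub (hE _ _)]
    have := hP (Function.update (fun j => q.1 j && q.2.1 j) i true)
      (Function.update (fun j => !q.1 j && q.2.2 j) i true)
    linarith
  have hr' : (∑ i, Finset.expect Finset.univ fun q => P.real (E1 i q)) ≤ n * (1 / 26) := by
    refine (Finset.sum_le_sum fun i _ => hr i).trans (by simp)
  have hnpos : (0 : ℝ) < n := by exact_mod_cast hn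
  have hl' := mul_le_mul_of_nonneg_left hl hnpos.le
  -- The error `1 / 26` is chosen so that `25 / 26 - 12 / 26 = 1 / 2`.
  have hfin : (n : ℝ) * (1 / 2) ≤ n * (20 * Fintype.card ι * Real.exp (-(n / 80))) := by
    rw [hC] at hmono
    linarith
  have hfin' := le_of_mul_le_mul_left hfin hnpos
  have hexp : Real.exp (-(n / 80)) * Real.exp (n / 80) = 1 := by
    rw [← Real.exp_add]
    simp
  have := mul_le_mul_of_nonneg_right hfin' (Real.exp_pos ((n : ℝ) / 80)).le
  rw [mul_assoc, hexp] at this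
  linarith

/-! ### Two-player simulation of a distributed algorithm. -/

theorem card_message_le (B : ℕ) : Nat.card (Message B) ≤ 4 ^ B ∧ Finite (Message B) := by
  let F : (Fin B → Bool) × Fin (B + 1) → Message B := fun q =>
    ⟨(List.ofFn q.1).take q.2, by simp⟩
  have hF : Function.Surjective F := by
    rintro ⟨m, hm⟩
    refine ⟨(fun i => m.getD i false, ⟨m.length, by omega⟩), Subtype.ext ?_⟩
    refine List.ext_getElem (by simp [F, hm]) fun i h1 h2 => ?_
    simp only [F, List.getElem_take, List.getElem_ofFn]
    exact (List.getElem_eq_getD false).symm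
  refine ⟨(Nat.card_le_card_of_surjective F hF).trans ?_, Finite.of_surjective F hF⟩
  have : B + 1 ≤ 2 ^ B := Nat.lt_two_pow_self
  rw [Nat.card_prod, Nat.card_eq_fintype_card, Nat.card_eq_fintype_card, Fintype.card_fun,
    Fintype.card_bool, Fintype.card_fin, Fintype.card_fin]
  calc 2 ^ B * (B + 1) ≤ 2 ^ B * 2 ^ B := Nat.mul_le_mul_left _ this
    _ = 4 ^ B := by rw [← Nat.mul_pow]

/-- Two families of vertex sets and a family of directed edges that allow two players to simulate
`T` rounds: in round `t` the players hold the states of `SA t` and `SB t`, and only the messages on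
the edges `slot t k` have to be exchanged. -/
structure IsSimulationScheme {V κ : Type*} (G : SimpleGraph V) (SA SB : ℕ → Set V)
    (slot : ℕ → κ → V × V) (T : ℕ) : Prop where
  cover : ∀ t < T, ∀ v, v ∈ SA t ∨ v ∈ SB t
  left_anti : ∀ t < T, SA (t + 1) ⊆ SA t
  right_anti : ∀ t < T, SB (t + 1) ⊆ SB t
  left_adj : ∀ t < T, ∀ v ∈ SA (t + 1), ∀ w, G.Adj w v → w ∈ SA t ∨ ∃ k, slot t k = (w, v)
  right_adj : ∀ t < T, ∀ v ∈ SB (t + 1), ∀ w, G.Adj w v → w ∈ SB t ∨ ∃ k, slot t k = (w, v)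

namespace DistAlg

variable {V : Type*} {G : SimpleGraph V} {B b : ℕ} {Ω S : Type*}

open Classical in
/-- The message sent along a pair of vertices in round `t + 1` (empty if the pair is no edge). -/
noncomputable def messageOn (A : DistAlg G B b Ω S) (ω : Ω) (inp : V → Option (Fin b → Bool))
    (t : ℕ) (e : V × V) : Message B :=
  if h : G.Adj e.1 e.2 then A.send ω e.1 (A.state ω inp t e.1) ⟨e.2, h⟩ else ⟨[], by simp⟩

theorem messageOn_congr (A : DistAlg G B b Ω S) (ω : Ω) {inp inp' : V → Option (Fin b → Bool)}
    {t : ℕ} {e : V × V} (h : A.state ω inp t e.1 = A.state ω inp' t e.1) :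
    A.messageOn ω inp t e = A.messageOn ω inp' t e := by
  unfold messageOn
  rw [h]

theorem messageOn_of_adj (A : DistAlg G B b Ω S) (ω : Ω) (inp : V → Option (Fin b → Bool))
    (t : ℕ) {w v : V} (h : G.Adj w v) :
    A.messageOn ω inp t (w, v) = A.send ω w (A.state ω inp t w) ⟨v, h⟩ :=
  dif_pos h

/-- If a vertex has the same state and receives the same messages, its next state is the same. -/
theorem state_succ_congr (A : DistAlg G B b Ω S) (ω : Ω) {inp inp' : V → Option (Fin b → Bool)}
    {t : ℕ} {v : V} (hs : A.state ω inp t v = A.state ω inp' t v)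
    (hm : ∀ w, G.Adj w v → A.messageOn ω inp t (w, v) = A.messageOn ω inp' t (w, v)) :
    A.state ω inp (t + 1) v = A.state ω inp' (t + 1) v := by
  simp only [state]
  rw [hs]
  congr 1
  ext1 u
  have := hm u.1 (SimpleGraph.Adj.symm u.2)
  rwa [messageOn_of_adj, messageOn_of_adj] at this

/-- If two executions exchange the same messages on the slots, then the execution on the crossed
input looks like the first one to the left player and like the second one to the right player. -/
theorem state_crossed {κ : Type*} {SA SB : ℕ → Set V} {slot : ℕ → κ → V × V} {T : ℕ}
    (hsim : IsSimulationScheme G SA SB slot T) (A : DistAlg G B b Ω S) (ω : Ω)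
    {inp inp₁ inp₂ : V → Option (Fin b → Bool)} (hA : ∀ v ∈ SA 0, inp v = inp₁ v)
    (hB : ∀ v ∈ SB 0, inp v = inp₂ v)
    (htr : ∀ t < T, ∀ k, A.messageOn ω inp₁ t (slot t k) = A.messageOn ω inp₂ t (slot t k)) :
    ∀ t ≤ T, (∀ v ∈ SA t, A.state ω inp t v = A.state ω inp₁ t v) ∧
      ∀ v ∈ SB t, A.state ω inp t v = A.state ω inp₂ t v := by
  intro t
  induction t with
  | zero =>
    intro _
    exact ⟨fun v hv => by simp only [state, hA v hv], fun v hv => by simp only [state, hB v hv]⟩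
  | succ t ih =>
    intro ht
    obtain ⟨iA, iB⟩ := ih (by omega)
    refine ⟨fun v hv => A.state_succ_congr ω (iA v (hsim.left_anti t ht hv)) fun w hw => ?_,
      fun v hv => A.state_succ_congr ω (iB v (hsim.right_anti t ht hv)) fun w hw => ?_⟩
    · by_cases hwA : w ∈ SA t
      · exact A.messageOn_congr ω (iA w hwA)
      · obtain ⟨k, hk⟩ := (hsim.left_adj t ht v hv w hw).resolve_left hwA
        have h1 := htr t ht k
        rw [hk] at h1
        rw [h1]
        -- A sender outside the left set is held by the right player, so it acts as on `inp₂`; its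
        -- slot message agrees with that on `inp₁`.
        exact A.messageOn_congr ω (iB w ((hsim.cover t ht w).resolve_left hwA))
    · by_cases hwB : w ∈ SB t
      · exact A.messageOn_congr ω (iB w hwB)
      · obtain ⟨k, hk⟩ := (hsim.right_adj t ht v hv w hw).resolve_left hwB
        have h1 := htr t ht k
        rw [hk] at h1
        rw [← h1]
        exact A.messageOn_congr ω (iA w ((hsim.cover t ht w).resolve_right hwB))

/-- By `cover`, one of the players holds the sender of each slot. This closes the transcript classes
under crossing inputs. -/
theorem messageOn_crossed {κ : Type*} {SA SB : ℕ → Set V} {slot : ℕ → κ → V × V} {T : ℕ}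
    (hsim : IsSimulationScheme G SA SB slot T) (A : DistAlg G B b Ω S) (ω : Ω)
    {inp inp₁ inp₂ : V → Option (Fin b → Bool)} (hA : ∀ v ∈ SA 0, inp v = inp₁ v)
    (hB : ∀ v ∈ SB 0, inp v = inp₂ v)
    (htr : ∀ t < T, ∀ k, A.messageOn ω inp₁ t (slot t k) = A.messageOn ω inp₂ t (slot t k)) :
    ∀ t < T, ∀ k, A.messageOn ω inp t (slot t k) = A.messageOn ω inp₁ t (slot t k) := by
  intro t ht k
  obtain ⟨iA, iB⟩ := A.state_crossed hsim ω hA hB htr t ht.le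
  rcases hsim.cover t ht (slot t k).1 with h | h
  · exact A.messageOn_congr ω (iA _ h)
  · exact (A.messageOn_congr ω (iB _ h)).trans (htr t ht k).symm

/-- The output of a vertex that decides by time `T` is determined by its states up to time `T`. -/
theorem Outputs.congr {A : DistAlg G B b Ω S} {ω : Ω} {inp inp' : V → Option (Fin b → Bool)}
    {v : V} {a : Bool} {T : ℕ} (hT : A.decisionTime ω inp v ≤ T)
    (hs : ∀ t ≤ T, A.state ω inp t v = A.state ω inp' t v) (h : A.Outputs ω inp v a) :
    A.Outputs ω inp' v a := by
  obtain ⟨t, ht, hlt⟩ := h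
  have htT : t ≤ T := by
    by_contra hcon
    have : (t : ℕ∞) ≤ A.decisionTime ω inp v := by
      refine le_iInf fun t' => le_iInf fun h' => ?_
      by_contra hc
      have hc' : t' < t := by exact_mod_cast not_le.1 hc
      rw [hlt t' hc'] at h'
      simp at h'
    have h2 : (t : ℕ∞) ≤ T := this.trans hT
    exact hcon (by exact_mod_cast h2)
  refine ⟨t, by rw [← hs t htT, ht], fun t' ht' => ?_⟩
  rw [← hs t' (ht'.le.trans htT), hlt t' ht']

theorem Outputs.unique {A : DistAlg G B b Ω S} {ω : Ω} {inp : V → Option (Fin b → Bool)}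
    {v : V} {a a' : Bool} (h : A.Outputs ω inp v a) (h' : A.Outputs ω inp v a') : a = a' := by
  obtain ⟨t, ht, hlt⟩ := h
  obtain ⟨t', ht', hlt'⟩ := h'
  rcases lt_trichotomy t t' with hc | hc | hc
  · rw [hlt' t hc] at ht
    simp at ht
  · subst hc
    rw [ht] at ht'
    exact Option.some.inj ht'
  · rw [hlt t' hc] at ht'
    simp at ht'

theorem decisionTime_le_worstCaseTime [DecidableEq V] (A : DistAlg G B b Ω S) (s r : V) (ω : Ω)
    (x y : Fin b → Bool) :
    A.decisionTime ω (twoPartyInput s r x y) s ≤ A.worstCaseTime s r :=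
  (le_max_left _ _).trans <| le_iSup_of_le x <| le_iSup_of_le y <| le_iSup_of_le ω le_rfl

open MeasureTheory in
/-- A fast algorithm for set disjointness on a graph with a simulation scheme needs many message
slots. -/
theorem exp_le_of_simulation [DecidableEq V] {κ : Type*} [Fintype κ] {SA SB : ℕ → Set V}
    {slot : ℕ → κ → V × V} {T : ℕ} (hsim : IsSimulationScheme G SA SB slot T) {s r : V}
    (hsA : ∀ t ≤ T, s ∈ SA t) (hrA : r ∉ SA 0) (hsB : s ∉ SB 0) (hb : 1 ≤ b)
    [MeasurableSpace Ω] (P : Measure Ω) [IsProbabilityMeasure P] (A : DistAlg G B b Ω S)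
    (hA : A.ComputesWithError P s r disj (1 / 26)) (hT : A.worstCaseTime s r ≤ T) :
    Real.exp (b / 80) ≤ 40 * ((4 : ℝ) ^ B) ^ (Fintype.card κ * T) := by
  classical
  obtain ⟨hcard, hfin⟩ := card_message_le B
  let _ : Fintype (Message B) := Fintype.ofFinite _
  have hmain := exp_le_card_transcripts hb (ι := Fin T → κ → Message B) P
    (fun ω x y t k => A.messageOn ω (twoPartyInput s r x y) t (slot t k))
    -- The output of `s` alone decides: `s` stays with the left player, so within a transcript class
    -- it depends only on `x`.
    (fun ω x y => A.Outputs ω (twoPartyInput s r x y) s true)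
    (by
      intro ω x y x' y' h
      have htr : ∀ t < T, ∀ k, A.messageOn ω (twoPartyInput s r x y) t (slot t k) =
          A.messageOn ω (twoPartyInput s r x' y') t (slot t k) := fun t ht k =>
        congrFun (congrFun h ⟨t, ht⟩) k
      have iA : ∀ v ∈ SA 0, twoPartyInput s r x y' v = twoPartyInput s r x y v := by
        intro v hv
        have : v ≠ r := fun h => hrA (h ▸ hv)
        simp [twoPartyInput, this]
      have iB : ∀ v ∈ SB 0, twoPartyInput s r x y' v = twoPartyInput s r x' y' v := by
        intro v hv
        have : v ≠ s := fun h => hsB (h ▸ hv)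
        simp [twoPartyInput, this]
      have hst := fun t ht => (A.state_crossed hsim ω iA iB htr t ht).1 s (hsA t ht)
      refine ⟨?_, ?_, ?_⟩
      · ext1 t
        ext1 k
        exact A.messageOn_crossed hsim ω iA iB htr t t.2 k
      · exact Outputs.congr ((A.decisionTime_le_worstCaseTime s r ω x y').trans hT) hst
      · exact Outputs.congr ((A.decisionTime_le_worstCaseTime s r ω x y).trans hT)
          fun t ht => (hst t ht).symm)
    _ (fun x y => (hA x y).1) (fun x y => le_trans (by norm_num) (hA x y).2)
    (fun x y hxy ω hω => hxy ▸ hω.1)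
    (fun x y hxy ω hω h => by
      have := Outputs.unique hω.1 h
      rw [hxy] at this
      simp at this)
  refine hmain.trans ?_
  have hc : Fintype.card (Fin T → κ → Message B) ≤ (4 ^ B) ^ (Fintype.card κ * T) := by
    rw [Nat.card_eq_fintype_card] at hcard
    simp only [Fintype.card_pi, Finset.prod_const, Finset.card_univ, Fintype.card_fin, ← pow_mul]
    rw [pow_mul]
    calc _ ≤ (4 ^ B) ^ (Fintype.card κ * T) := by
          rw [← pow_mul]
          exact Nat.pow_le_pow_left hcard _
      _ = _ := by rw [← pow_mul]
  have hc' : (Fintype.card (Fin T → κ → Message B) : ℝ) ≤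
      ((4 : ℝ) ^ B) ^ (Fintype.card κ * T) := by exact_mod_cast hc
  linarith

end DistAlg

/-! ### The simulation scheme on the network. -/

/-- The vertices with a descendant at a position `≤ a`. -/
def ptLower (Γ d p a : ℕ) : Set (PTVertex Γ d p)
  | .path _ j => (j : ℕ) ≤ a
  | .tree l i => (i : ℕ) ≤ a / d ^ (p - l)

/-- The vertices with a descendant at a position `≥ a`. -/
def ptUpper (Γ d p a : ℕ) : Set (PTVertex Γ d p)
  | .path _ j => a ≤ (j : ℕ)
  | .tree l i => a / d ^ (p - l) ≤ (i : ℕ)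

section

variable {Γ d p : ℕ}

theorem path_mem_ptLower {a : ℕ} {k : Fin Γ} {j : Fin (d ^ p)} :
    PTVertex.path k j ∈ ptLower Γ d p a ↔ (j : ℕ) ≤ a := Iff.rfl

theorem tree_mem_ptLower {a : ℕ} {l : Fin (p + 1)} {i : Fin (d ^ (l : ℕ))} :
    PTVertex.tree l i ∈ ptLower Γ d p a ↔ (i : ℕ) ≤ a / d ^ (p - l) := Iff.rfl

theorem path_mem_ptUpper {a : ℕ} {k : Fin Γ} {j : Fin (d ^ p)} :
    PTVertex.path k j ∈ ptUpper Γ d p a ↔ a ≤ (j : ℕ) := Iff.rfl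

theorem tree_mem_ptUpper {a : ℕ} {l : Fin (p + 1)} {i : Fin (d ^ (l : ℕ))} :
    PTVertex.tree l i ∈ ptUpper Γ d p a ↔ a / d ^ (p - l) ≤ (i : ℕ) := Iff.rfl

theorem ptLower_mono {a a' : ℕ} (h : a ≤ a') : ptLower Γ d p a ⊆ ptLower Γ d p a' := by
  rintro (⟨k, j⟩ | ⟨l, i⟩) hv
  · exact le_trans (path_mem_ptLower.1 hv) h
  · exact le_trans (tree_mem_ptLower.1 hv) (Nat.div_le_div_right h)

theorem ptUpper_anti {a a' : ℕ} (h : a ≤ a') : ptUpper Γ d p a' ⊆ ptUpper Γ d p a := by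
  rintro (⟨k, j⟩ | ⟨l, i⟩) hv
  · exact le_trans h (path_mem_ptUpper.1 hv)
  · exact le_trans (Nat.div_le_div_right h) (tree_mem_ptUpper.1 hv)

theorem mem_ptLower_or_mem_ptUpper {a b : ℕ} (h : b ≤ a) (v : PTVertex Γ d p) :
    v ∈ ptLower Γ d p a ∨ v ∈ ptUpper Γ d p b := by
  rcases v with ⟨k, j⟩ | ⟨l, i⟩
  · rw [path_mem_ptLower, path_mem_ptUpper]
    omega
  · rw [tree_mem_ptLower, tree_mem_ptUpper]
    have : b / d ^ (p - l) ≤ a / d ^ (p - l) := Nat.div_le_div_right h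
    omega

theorem div_pow_sub_div {l : ℕ} (hl : l + 1 ≤ p) (a : ℕ) :
    a / d ^ (p - (l + 1)) / d = a / d ^ (p - l) := by
  rw [Nat.div_div_eq_div_mul, ← pow_succ]
  congr 2
  omega

/-- `w` is a child of `v`, and `v` is the tree vertex of its level that is an ancestor of the
leaf with number `c`. -/
def IsChildOfAncestor (c : ℕ) (w v : PTVertex Γ d p) : Prop :=
  ∃ (l : Fin p) (i : Fin (d ^ (l : ℕ))) (i' : Fin (d ^ ((l : ℕ) + 1))),
    (i' : ℕ) / d = i ∧ (i : ℕ) = c / d ^ (p - l) ∧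
      w = .tree l.succ i' ∧ v = .tree l.castSucc i

/-- Path edges move the position by one, spokes preserve it, and parents of lower vertices are
lower. Only a step down the tree can leave the set, and only from the ancestor of the boundary leaf.
-/
theorem ptGraph_adj_of_mem_ptLower {a a' : ℕ} (h : a' + 1 ≤ a) {v w : PTVertex Γ d p}
    (hv : v ∈ ptLower Γ d p a') (hw : (ptGraph Γ d p).Adj w v) :
    w ∈ ptLower Γ d p a ∨ IsChildOfAncestor a' w v := by
  obtain ⟨-, hw⟩ := (SimpleGraph.fromRel_adj _ _ _).1 hw
  rcases v with ⟨k, j⟩ | ⟨⟨l, hl⟩, i⟩ <;> rcases w with ⟨k', j'⟩ | ⟨⟨l', hl'⟩, i'⟩ <;>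
    simp only [ptEdge, or_false, false_or] at hw
  · left
    rw [path_mem_ptLower] at *
    omega
  · left
    obtain ⟨rfl, hij⟩ := hw
    rw [path_mem_ptLower] at hv
    rw [tree_mem_ptLower]
    simp only [Nat.sub_self, pow_zero, Nat.div_one]
    omega
  · left
    obtain ⟨rfl, hij⟩ := hw
    rw [tree_mem_ptLower] at hv
    simp only [Nat.sub_self, pow_zero, Nat.div_one] at hv
    rw [path_mem_ptLower]
    omega
  · rw [tree_mem_ptLower] at hv
    rw [tree_mem_ptLower]
    simp only at hv ⊢
    rcases hw with ⟨rfl, hi⟩ | ⟨rfl, hi⟩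
    · left
      rw [← div_pow_sub_div (by omega), ← hi]
      exact Nat.div_le_div_right (hv.trans (Nat.div_le_div_right (by omega)))
    · by_cases hc : (i' : ℕ) ≤ a / d ^ (p - (l + 1))
      · exact Or.inl hc
      · right
        -- A child beyond the boundary forces its parent to be at or beyond the ancestor of `a`,
        -- while `hv` puts it at or before that of `a'`; hence equality.
        have h1 : a / d ^ (p - (l + 1)) / d ≤ i' / d := Nat.div_le_div_right (by omega)
        rw [div_pow_sub_div (by omega), hi] at h1
        have h2 : a' / d ^ (p - l) ≤ a / d ^ (p - l) := Nat.div_le_div_right (by omega)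
        exact ⟨⟨l, by omega⟩, i, i', hi, by simp only; omega, rfl, rfl⟩

theorem ptGraph_adj_of_mem_ptUpper {a a' : ℕ} (h : a + 1 ≤ a') {v w : PTVertex Γ d p}
    (hv : v ∈ ptUpper Γ d p a') (hw : (ptGraph Γ d p).Adj w v) :
    w ∈ ptUpper Γ d p a ∨ IsChildOfAncestor a' w v := by
  obtain ⟨-, hw⟩ := (SimpleGraph.fromRel_adj _ _ _).1 hw
  rcases v with ⟨k, j⟩ | ⟨⟨l, hl⟩, i⟩ <;> rcases w with ⟨k', j'⟩ | ⟨⟨l', hl'⟩, i'⟩ <;>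
    simp only [ptEdge, or_false, false_or] at hw
  · left
    rw [path_mem_ptUpper] at *
    omega
  · left
    obtain ⟨rfl, hij⟩ := hw
    rw [path_mem_ptUpper] at hv
    rw [tree_mem_ptUpper]
    simp only [Nat.sub_self, pow_zero, Nat.div_one]
    omega
  · left
    obtain ⟨rfl, hij⟩ := hw
    rw [tree_mem_ptUpper] at hv
    simp only [Nat.sub_self, pow_zero, Nat.div_one] at hv
    rw [path_mem_ptUpper]
    omega
  · rw [tree_mem_ptUpper] at hv
    rw [tree_mem_ptUpper]
    simp only at hv ⊢
    rcases hw with ⟨rfl, hi⟩ | ⟨rfl, hi⟩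
    · left
      rw [← div_pow_sub_div (by omega), ← hi]
      exact Nat.div_le_div_right (le_trans (Nat.div_le_div_right (by omega)) hv)
    · by_cases hc : a / d ^ (p - (l + 1)) ≤ i'
      · exact Or.inl hc
      · right
        have h1 : i' / d ≤ a / d ^ (p - (l + 1)) / d := Nat.div_le_div_right (by omega)
        rw [div_pow_sub_div (by omega), hi] at h1
        have h2 : a / d ^ (p - l) ≤ a' / d ^ (p - l) := Nat.div_le_div_right (by omega)
        exact ⟨⟨l, by omega⟩, i, i', hi, by simp only; omega, rfl, rfl⟩

/-- The edge from the `e`-th child of the ancestor of leaf `c` on level `l` to that ancestor. -/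
def ancestorEdge (v₀ : PTVertex Γ d p) (c : ℕ) (l : Fin p) (e : Fin d) :
    PTVertex Γ d p × PTVertex Γ d p :=
  if h : c / d ^ (p - l) < d ^ (l : ℕ) ∧ d * (c / d ^ (p - l)) + e < d ^ ((l : ℕ) + 1) then
    (.tree l.succ ⟨d * (c / d ^ (p - l)) + e, h.2⟩, .tree l.castSucc ⟨c / d ^ (p - l), h.1⟩)
  -- A loop is no edge, so an unused slot carries the empty message.
  else (v₀, v₀)

theorem IsChildOfAncestor.exists_ancestorEdge_eq {c : ℕ} {v w : PTVertex Γ d p} (hd : 0 < d)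
    (h : IsChildOfAncestor c w v) (v₀ : PTVertex Γ d p) :
    ∃ l e, ancestorEdge v₀ c l e = (w, v) := by
  obtain ⟨l, i, i', h1, h2, rfl, rfl⟩ := h
  have h3 : d * (c / d ^ (p - l)) + i' % d = i' := by
    rw [← h2, ← h1]
    exact Nat.div_add_mod _ _
  refine ⟨l, ⟨i' % d, Nat.mod_lt _ hd⟩, ?_⟩
  rw [ancestorEdge, dif_pos ⟨h2 ▸ i.2, h3.symm ▸ i'.2⟩]
  congr 2
  · exact Fin.ext h3
  · exact Fin.ext h2.symm

/-- The simulation of `T` rounds on `G(Γ, d, p)`, as long as `T` is less than half of the length of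
the paths. -/
theorem ptGraph_isSimulationScheme (hd : 2 ≤ d) {T : ℕ} (hT : 2 * T + 2 ≤ d ^ p) :
    IsSimulationScheme (ptGraph Γ d p) (fun t => ptLower Γ d p (d ^ p - 2 - t))
      (fun t => ptUpper Γ d p (t + 1))
      (fun t (k : Bool × Fin p × Fin d) =>
        ancestorEdge (ptS Γ p hd) (if k.1 then d ^ p - 2 - (t + 1) else t + 2) k.2.1 k.2.2) T where
  -- The sets start at `d ^ p - 2` and `1`, just missing `r` and `s`; they still overlap while `t +
  -- 1 ≤ d ^ p - 2 - t`.
  cover t ht v := mem_ptLower_or_mem_ptUpper (by omega) v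
  left_anti t ht := ptLower_mono (by omega)
  right_anti t ht := ptUpper_anti (by omega)
  left_adj t ht v hv w hw := by
    refine (ptGraph_adj_of_mem_ptLower (by omega) hv hw).imp_right fun h => ?_
    obtain ⟨l, e, hle⟩ := h.exists_ancestorEdge_eq (by omega) (ptS Γ p hd)
    exact ⟨(true, l, e), hle⟩
  right_adj t ht v hv w hw := by
    refine (ptGraph_adj_of_mem_ptUpper (by omega) hv hw).imp_right fun h => ?_
    obtain ⟨l, e, hle⟩ := h.exists_ancestorEdge_eq (by omega) (ptS Γ p hd)
    exact ⟨(false, l, e), hle⟩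

end

/-! ### Zero-round algorithms and the final estimate. -/

/-- Without communication `s` cannot distinguish `y = 0` from `y = 1` when `x` is all ones, yet the
answers differ. Needed to absorb additive constants when `d ^ p` is small compared with `T`. -/
theorem DistAlg.one_le_worstCaseTime {V : Type*} [DecidableEq V] {G : SimpleGraph V} {B b : ℕ}
    {Ω S : Type*} [MeasurableSpace Ω] (P : MeasureTheory.Measure Ω)
    [MeasureTheory.IsProbabilityMeasure P] (A : DistAlg G B b Ω S) {s r : V} (hb : 1 ≤ b)
    (hA : A.ComputesWithError P s r disj (1 / 26)) : 1 ≤ A.worstCaseTime s r := by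
  by_contra hcon
  have h0 : A.worstCaseTime s r ≤ (0 : ℕ) := by
    rw [Order.one_le_iff_ne_zero, not_not] at hcon
    simp [hcon]
  let x : Fin b → Bool := fun _ => true
  let y : Fin b → Bool := fun _ => false
  have h1 := (hA x y).2
  obtain ⟨hm2, h2⟩ := hA x x
  -- The two success probabilities sum to more than 1, so a single `ω` is correct on both inputs.
  have hlt := lt_of_lt_of_le (a := 1) (b := 1 - 1 / 26 + (1 - 1 / 26)) (by norm_num) (add_le_add h1 h2)
  rw [← MeasureTheory.probReal_univ (μ := P)] at hlt
  have hne := MeasureTheory.nonempty_inter_of_measureReal_lt_add (μ := P) hm2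
    (Set.subset_univ _) (Set.subset_univ _) hlt
  obtain ⟨ω, ho1, ho2⟩ := hne
  have hxy : disj x y = true := by simp [disj, x, y]
  have hxx : disj x x = false := by
    simp only [disj, decide_eq_false_iff_not]
    exact fun h => h ⟨0, hb⟩ ⟨rfl, rfl⟩
  have ho1' := Outputs.congr (inp' := twoPartyInput s r x x)
    ((A.decisionTime_le_worstCaseTime s r ω x y).trans h0)
    (fun t ht => by
      obtain rfl : t = 0 := by omega
      simp [state, twoPartyInput]) ho1.1
  have := ho1'.unique ho2.1
  rw [hxy, hxx] at this
  simp at this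

/-- The elementary estimate that turns the bound on the number of transcripts into a bound on the
number of bits exchanged. -/
theorem le_of_exp_le {b B k : ℕ} (hk : 1 ≤ B * k)
    (h : Real.exp (b / 80) ≤ 40 * ((4 : ℝ) ^ B) ^ k) : (b : ℝ) ≤ 480 * (B * k) := by
  have hlog := Real.log_le_log (Real.exp_pos _) h
  rw [Real.log_exp, ← pow_mul, Real.log_mul (by norm_num) (by positivity), Real.log_pow] at hlog
  have h2 := Real.log_two_lt_d9
  have h4 : Real.log 4 = 2 * Real.log 2 := by
    rw [show (4 : ℝ) = 2 ^ 2 by norm_num, Real.log_pow]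
    norm_num
  have h40 : Real.log 40 ≤ 6 * Real.log 2 := by
    have : Real.log 40 ≤ Real.log (2 ^ 6) := Real.log_le_log (by norm_num) (by norm_num)
    rwa [Real.log_pow] at this
  have hk' : (1 : ℝ) ≤ B * k := by exact_mod_cast hk
  push_cast at hlog
  rw [h4] at hlog
  -- `b / 80 ≤ (6 + 2 * B * k) * log 2 ≤ 8 * B * k * log 2`, and `640 * log 2 < 480`.
  nlinarith

theorem lemma4p1 :
    ∃ ε : ℝ, 0 < ε ∧ ∃ c : ℝ, 0 < c ∧
      ∀ (Γ d p B b : ℕ) (hd : 2 ≤ d) (_ : 1 ≤ p) (_ : 1 ≤ B)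
        (Ω S : Type*) [MeasurableSpace Ω] (P : MeasureTheory.Measure Ω)
        [MeasureTheory.IsProbabilityMeasure P]
        (A : DistAlg (ptGraph Γ d p) B b Ω S),
        A.ComputesWithError P (ptS Γ p hd) (ptR Γ p hd) disj ε →
        ∀ T : ℕ, A.worstCaseTime (ptS Γ p hd) (ptR Γ p hd) ≤ (T : ℕ∞) →
          c * min ((d : ℝ) ^ p) ((b : ℝ) / ((d : ℝ) * (p : ℝ) * (B : ℝ))) ≤ (T : ℝ) := by
  refine ⟨1 / 26, by norm_num, 1 / 960, by norm_num, ?_⟩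
  intro Γ d p B b hd hp hB Ω S _ P _ A hA T hT
  rcases Nat.eq_zero_or_pos b with rfl | hb
  · have h1 : min ((d : ℝ) ^ p) (((0 : ℕ) : ℝ) / ((d : ℝ) * (p : ℝ) * (B : ℝ))) ≤ 0 :=
      (min_le_right _ _).trans (by simp)
    have h2 : (0 : ℝ) ≤ T := Nat.cast_nonneg T
    linarith
  have hT1 : 1 ≤ T := by exact_mod_cast (A.one_le_worstCaseTime P hb hA).trans hT
  have hT1' : (1 : ℝ) ≤ T := by exact_mod_cast hT1
  rcases Nat.lt_or_ge (d ^ p) (2 * T + 2) with hN | hN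
  · have h1 : ((d : ℝ) ^ p) ≤ 2 * T + 2 := by exact_mod_cast hN.le
    have h2 := (min_le_left ((d : ℝ) ^ p) ((b : ℝ) / ((d : ℝ) * (p : ℝ) * (B : ℝ)))).trans h1
    -- `T ≥ 1` gives `2 * T + 2 ≤ 4 * T`, well below `960 * T`.
    linarith
  · have hsim := ptGraph_isSimulationScheme (Γ := Γ) hd hN
    have hexp := DistAlg.exp_le_of_simulation hsim (s := ptS Γ p hd) (r := ptR Γ p hd)
      (fun t _ => tree_mem_ptLower.2 (Nat.zero_le _))
      (fun h => by
        have := tree_mem_ptLower.1 h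
        simp only [Fin.val_last, Nat.sub_self, pow_zero, Nat.div_one] at this
        omega)
      (fun h => by
        have := tree_mem_ptUpper.1 h
        simp at this)
      hb P A hA hT
    have hcard : Fintype.card (Bool × Fin p × Fin d) = 2 * (p * d) := by simp
    rw [hcard] at hexp
    have hle := le_of_exp_le
      (Nat.mul_pos hB (Nat.mul_pos (Nat.mul_pos two_pos (Nat.mul_pos hp (by omega))) hT1)) hexp
    push_cast at hle
    have hd' : (0 : ℝ) < d := by exact_mod_cast (by omega : 0 < d)
    have hp' : (0 : ℝ) < p := by exact_mod_cast hp
    have hB' : (0 : ℝ) < B := by exact_mod_cast hB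
    -- The constant is `480` times the `2` from having two players' slots.
    have h1 : (b : ℝ) / ((d : ℝ) * (p : ℝ) * (B : ℝ)) ≤ 960 * T := by
      rw [div_le_iff₀ (by positivity)]
      linarith
    have h2 := (min_le_right ((d : ℝ) ^ p) ((b : ℝ) / ((d : ℝ) * (p : ℝ) * (B : ℝ)))).trans h1
    linarith
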